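/- Let $G$ be a finite simple graph with $n\ge 1$ vertices, let $\lambda_1\ge\lambda_2\ge\cdots\ge\lambda_n$ be the eigenvalues of its adjacency matrix, counted with multiplicity, and put $H=\lfloor \frac{n+1}{2}\rfloor$ and $L=\lceil \frac{n+1}{2}\rceil$. If $G$ is subcubic, that is, if every vertex of $G$ has degree at most $3$, then the median eigenvalues satisfy $\lambda_H,\lambda_L\in[-\sqrt2,\sqrt2\,]$. Consequently, with the HL-index $R(G)=\max\{|\lambda_H|,|\lambda_L|\}$ and $R(3)=\sup\{R(G)\}$, where the supremum is taken over all finite simple graphs $G$ with at least one vertex and maximum degree at most $3$, we have $R(3)=\sqrt2$. -/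

import Mathlib

/-- `H = ⌊(n+1)/2⌋`. -/
def indexH (n : ℕ) : ℕ := ⌊((n : ℚ) + 1) / 2⌋₊

/-- `L = ⌈(n+1)/2⌉`. -/
def indexL (n : ℕ) : ℕ := ⌈((n : ℚ) + 1) / 2⌉₊

theorem indexH_eq (n : ℕ) : indexH n = (n + 1) / 2 := by
  have h := Nat.floor_div_eq_div (K := ℚ) (n + 1) 2
  push_cast at h
  exact h

theorem indexL_eq (n : ℕ) : indexL n = (n + 2) / 2 := by
  rw [indexL, Nat.ceil_eq_iff (by omega), Nat.cast_sub (by omega)]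
  have h : n = 2 * (n / 2) ∨ n = 2 * (n / 2) + 1 := by omega
  generalize n / 2 = k at h
  rcases h with rfl | rfl
  · rw [show (2 * k + 2) / 2 = k + 1 by omega]
    push_cast
    constructor <;> linarith
  · rw [show (2 * k + 1 + 2) / 2 = k + 1 by omega]
    push_cast
    constructor <;> linarith

section

variable {V : Type*} [Fintype V] [DecidableEq V]

/-- `eig G i` is the `i`-th largest eigenvalue `λ_i` of the adjacency matrix of `G`, counted with
multiplicity, for `1 ≤ i ≤ n`. (`eigenvalues₀` lists the eigenvalues in decreasing order,
indexed from `0`.) -/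
noncomputable def eig (G : SimpleGraph V) [DecidableRel G.Adj] (i : ℕ)
    (hi : 1 ≤ i ∧ i ≤ Fintype.card V) : ℝ :=
  (G.isHermitian_adjMatrix (R := ℝ)).eigenvalues₀ ⟨i - 1, by omega⟩

variable [Nonempty V]

/-- The median eigenvalue `λ_H` of a nonempty graph. -/
noncomputable def lambdaH (G : SimpleGraph V) [DecidableRel G.Adj] : ℝ :=
  eig G (indexH (Fintype.card V)) (by
    have := Fintype.card_pos (α := V)
    rw [indexH_eq]; omega)

/-- The median eigenvalue `λ_L` of a nonempty graph. -/
noncomputable def lambdaL (G : SimpleGraph V) [DecidableRel G.Adj] : ℝ :=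
  eig G (indexL (Fintype.card V)) (by
    have := Fintype.card_pos (α := V)
    rw [indexL_eq]; omega)

/-- The HL-index `R(G) = max {|λ_H|, |λ_L|}`. -/
noncomputable def hlIndex (G : SimpleGraph V) [DecidableRel G.Adj] : ℝ :=
  max |lambdaH G| |lambdaL G|

end

/-- The set of all values `R(G)`, over the nonempty finite simple graphs `G` with `Δ(G) ≤ d`. -/
def hlIndexSet (d : ℝ) : Set ℝ :=
  {r | ∃ (V : Type) (_ : Fintype V) (_ : DecidableEq V) (_ : Nonempty V)
    (G : SimpleGraph V) (_ : DecidableRel G.Adj), (G.maxDegree : ℝ) ≤ d ∧ hlIndex G = r}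

/-- `R(d) = sup {R(G) | Δ(G) ≤ d}`. -/
noncomputable def hlIndexSup (d : ℝ) : ℝ := sSup (hlIndexSet d)

/-!
# Median eigenvalues of subcubic graphs

Let `A` be the adjacency matrix of a graph on `n` vertices with degrees `d_v ≤ 3`. The bounds say
that fewer than `n / 2` eigenvalues exceed `√2`, and fewer than `n / 2` lie below `-√2`.

**Upper bound.** Closed walks give `tr A = 0`, `tr A² = ∑ d_v`, `tr A³ ≥ 0` and
`tr A⁴ ≥ ∑ (2 d_v² - d_v)`, so that `tr (A⁴ - 11 A² + 18) ≥ ∑ 2 (d_v - 3)² ≥ 0`. With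
`(λ² - 2) (λ² - 9) = λ⁴ - 11 λ² + 18`, whose roots are the eigenvalues of the Heawood graph, put
`f = λ⁴ - 11 λ² + 18 + c λ³ + c' λ`; then `tr f(A) ≥ 0` as soon as `c ≥ 0`. The constants `c, c'`
are chosen so that, for some `k > 0`, `f ≤ k` on `[-3, 3]` and `f ≤ -k` on `[√2, 3]`. If half of
the eigenvalues exceeded `√2`, then `tr f(A) ≤ 0`, so equality would hold everywhere, all these
eigenvalues would be `3`, and `tr A² ≥ 9 n / 2` would exceed `3 n`. This is
`two_mul_card_sqrt_two_lt`.

**Lower bound.** The same argument applies to `-A` if the graph has no triangle, as then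
`tr A³ = 0`. A triangle is removed by induction (`two_mul_finrank_lt`): deleting its at most three
outside neighbors lowers the number of eigenvalues below `-√2` by at most as many, and isolates the
triangle, whose least eigenvalue is `-1`. The induction is carried out for subspaces of vectors
supported on a vertex set on which the form of `A + √2` is negative definite.

**Sharpness.** The square of the adjacency matrix of the Heawood graph is `2` plus a positive
semidefinite matrix, so all its eigenvalues have absolute value at least `√2`.
-/

open Matrix Finset

/-! ### The quartic test polynomial -/

/-- The quartic `λ⁴ + c λ³ - 11 λ² + c' λ + 18`, with `c = 10√2 - 12 > 0` and `c' = 72 - 74√2`.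
With `k = 108 - 48√2`, these constants make `f + k` vanish at `√2` and `3`, and `f - k` vanish at
`-3` and, to second order, at `-√2`. -/
noncomputable def testQuartic (t : ℝ) : ℝ :=
  t ^ 4 + (10 * √2 - 12) * t ^ 3 - 11 * t ^ 2 + (72 - 74 * √2) * t + 18

theorem sqrt_two_bounds : 1.41 < √2 ∧ √2 < 1.415 := by
  constructor
  · rw [Real.lt_sqrt (by norm_num)]; norm_num
  · rw [Real.sqrt_lt' (by norm_num)]; norm_num

theorem testQuartic_le {t : ℝ} (h₁ : -3 ≤ t) (h₂ : t ≤ 3) :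
    testQuartic t ≤ 108 - 48 * √2 := by
  obtain ⟨hl, hu⟩ := sqrt_two_bounds
  have hs : √2 ^ 2 = 2 := Real.sq_sqrt (by norm_num)
  have key : 108 - 48 * √2 - testQuartic t = (t + √2) ^ 2 * ((3 + t) * (15 - 8 * √2 - t)) := by
    rw [testQuartic]
    linear_combination (17 * t ^ 2 + 36 * t - 45 + 8 * √2 * (t + 3)) * hs
  have : 0 ≤ (t + √2) ^ 2 * ((3 + t) * (15 - 8 * √2 - t)) :=
    mul_nonneg (sq_nonneg _) (mul_nonneg (by linarith) (by linarith))
  linarith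

theorem testQuartic_lt {t : ℝ} (h₁ : √2 < t) (h₂ : t < 3) :
    testQuartic t < -(108 - 48 * √2) := by
  obtain ⟨hl, hu⟩ := sqrt_two_bounds
  have hs : √2 ^ 2 = 2 := Real.sq_sqrt (by norm_num)
  have key : testQuartic t + (108 - 48 * √2) =
      -((t - √2) * (3 - t) * ((t + √2) * (t + 3) + (10 * √2 - 12) * (t + 3 + √2))) := by
    rw [testQuartic]
    linear_combination (t ^ 2 + 18 * t - 63 + 10 * √2 * (t - 3)) * hs
  have : 0 < (t - √2) * (3 - t) * ((t + √2) * (t + 3) + (10 * √2 - 12) * (t + 3 + √2)) := by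
    have : 0 < 10 * √2 - 12 := by linarith
    have : 0 < t - √2 := by linarith
    have : 0 < 3 - t := by linarith
    have : 0 < t := by linarith
    positivity
  linarith

/-- The moment inequality behind both bounds: fewer than half of the `μ i` exceed `√2`. -/
theorem two_mul_card_sqrt_two_lt {ι : Type*} [Fintype ι] [Nonempty ι] (μ : ι → ℝ)
    (hlb : ∀ i, -3 ≤ μ i) (hub : ∀ i, μ i ≤ 3) (h1 : ∑ i, μ i = 0)
    (h2 : ∑ i, μ i ^ 2 ≤ 3 * Fintype.card ι) (h3 : 0 ≤ ∑ i, μ i ^ 3)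
    (h4 : 0 ≤ ∑ i, (μ i ^ 4 - 11 * μ i ^ 2 + 18)) :
    2 * #{i | √2 < μ i} < Fintype.card ι := by
  classical
  obtain ⟨hl, hu⟩ := sqrt_two_bounds
  by_contra! hN
  set S : Finset ι := {i | √2 < μ i} with hS
  have hN' : (Fintype.card ι : ℝ) ≤ 2 * #S := by exact_mod_cast hN
  have hpos : (0 : ℝ) < Fintype.card ι := by exact_mod_cast Fintype.card_pos
  set k : ℝ := 108 - 48 * √2 with hk
  have hk0 : 0 < k := by linarith
  -- the defect of the test quartic against the step function `-k` on `S`, `k` off `S`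
  set g : ι → ℝ := fun i => k - (if √2 < μ i then 2 * k else 0) - testQuartic (μ i) with hg
  have hg0 : ∀ i, 0 ≤ g i := fun i => by
    simp only [hg]
    split_ifs with h
    · rcases (hub i).lt_or_eq with h' | h'
      · linarith [testQuartic_lt h h']
      · rw [h', testQuartic]; linarith
    · linarith [testQuartic_le (hlb i) (hub i)]
  have hgsum : ∑ i, g i ≤ 0 := by
    have hq : 0 ≤ ∑ i, testQuartic (μ i) := by
      have : ∑ i, testQuartic (μ i) = ∑ i, (μ i ^ 4 - 11 * μ i ^ 2 + 18)
          + (10 * √2 - 12) * ∑ i, μ i ^ 3 + (72 - 74 * √2) * ∑ i, μ i := by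
        simp only [mul_sum, ← sum_add_distrib, testQuartic]
        exact sum_congr rfl fun i _ => by ring
      rw [this, h1]
      have : 0 ≤ (10 * √2 - 12) * ∑ i, μ i ^ 3 := mul_nonneg (by linarith) h3
      linarith
    have : ∑ i, g i = k * (Fintype.card ι - 2 * #S) - ∑ i, testQuartic (μ i) := by
      simp only [hg, sum_sub_distrib, ← sum_filter, sum_const, card_univ, nsmul_eq_mul, ← hS]
      ring
    nlinarith
  -- hence the defect vanishes, and all `μ i` above `√2` equal `3`, contradicting `h2`
  have hgz : ∀ i, g i = 0 := fun i =>
    (sum_eq_zero_iff_of_nonneg fun i _ => hg0 i).1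
      (le_antisymm hgsum (sum_nonneg fun i _ => hg0 i)) i (mem_univ i)
  have h9 : ∀ i ∈ S, (9 : ℝ) = μ i ^ 2 := fun i hi => by
    have hi' : √2 < μ i := by simpa [hS] using hi
    rcases (hub i).lt_or_eq with h' | h'
    · have := hgz i
      simp only [hg, if_pos hi'] at this
      linarith [testQuartic_lt hi' h']
    · rw [h']; norm_num
  have : (9 : ℝ) * #S ≤ ∑ i, μ i ^ 2 := by
    calc (9 : ℝ) * #S = ∑ i ∈ S, μ i ^ 2 := by
          rw [← sum_congr rfl h9, sum_const, nsmul_eq_mul, mul_comm]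
      _ ≤ _ := sum_le_sum_of_subset_of_nonneg (subset_univ _) fun i _ _ => sq_nonneg _
  linarith

/-! ### Diagonalization of real symmetric matrices -/

section Diagonalization

variable {V : Type*} [Fintype V] [DecidableEq V] {A : Matrix V V ℝ}

theorem exists_orthogonal_diagonalization (hA : A.IsHermitian) :
    ∃ P : Matrix V V ℝ, Pᵀ * P = 1 ∧ P * Pᵀ = 1 ∧ A = P * diagonal hA.eigenvalues * Pᵀ := by
  refine ⟨hA.eigenvectorUnitary, ?_, ?_, ?_⟩
  · have := Unitary.coe_star_mul_self hA.eigenvectorUnitary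
    rwa [star_eq_conjTranspose, conjTranspose_eq_transpose_of_trivial] at this
  · have := Unitary.coe_mul_star_self hA.eigenvectorUnitary
    rwa [Unitary.coe_star, star_eq_conjTranspose, conjTranspose_eq_transpose_of_trivial] at this
  · have := hA.spectral_theorem
    rw [Unitary.conjStarAlgAut_apply, star_eq_conjTranspose,
      conjTranspose_eq_transpose_of_trivial] at this
    exact this

theorem trace_pow_eq_sum_eigenvalues_pow (hA : A.IsHermitian) (k : ℕ) :
    (A ^ k).trace = ∑ i, hA.eigenvalues i ^ k := by
  obtain ⟨P, hP, hP', h⟩ := exists_orthogonal_diagonalization hA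
  have : A ^ k = P * diagonal (fun i => hA.eigenvalues i ^ k) * Pᵀ := by
    induction k with
    | zero => simp [hP']
    | succ k ih =>
      rw [pow_succ, ih]
      nth_rw 2 [h]
      simp only [pow_succ, ← diagonal_mul_diagonal]
      simp only [Matrix.mul_assoc]
      rw [← Matrix.mul_assoc Pᵀ P, hP, Matrix.one_mul]
  rw [this, trace_mul_cycle, hP, Matrix.one_mul, trace_diagonal]

/-- In the orthonormal coordinates `Pᵀ x` of an eigenbasis, the quadratic form of `A` and the
Euclidean norm are both diagonal. -/
theorem exists_coordinates (hA : A.IsHermitian) :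
    ∃ P : Matrix V V ℝ, Pᵀ * P = 1 ∧
      (∀ x, x ⬝ᵥ A *ᵥ x = ∑ i, hA.eigenvalues i * (Pᵀ *ᵥ x) i ^ 2) ∧
      ∀ x, x ⬝ᵥ x = ∑ i, (Pᵀ *ᵥ x) i ^ 2 := by
  obtain ⟨P, hP, hP', h⟩ := exists_orthogonal_diagonalization hA
  refine ⟨P, hP, fun x => ?_, fun x => ?_⟩
  · conv_lhs => rw [h]
    rw [← mulVec_mulVec, ← mulVec_mulVec, dotProduct_mulVec, ← mulVec_transpose]
    simp only [dotProduct, mulVec_diagonal]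
    exact sum_congr rfl fun i _ => by ring
  · have : x ⬝ᵥ x = (Pᵀ *ᵥ x) ⬝ᵥ (Pᵀ *ᵥ x) := by
      rw [dotProduct_mulVec, ← mulVec_transpose, transpose_transpose, mulVec_mulVec, hP',
        one_mulVec]
    rw [this]
    simp only [dotProduct, sq]

theorem exists_eigenvector (hA : A.IsHermitian) (i : V) :
    ∃ x : V → ℝ, x ⬝ᵥ x = 1 ∧ A *ᵥ x = hA.eigenvalues i • x := by
  obtain ⟨P, hP, hP', h⟩ := exists_orthogonal_diagonalization hA
  refine ⟨P *ᵥ Pi.single i 1, ?_, ?_⟩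
  · rw [dotProduct_mulVec, ← mulVec_transpose, mulVec_mulVec, hP]
    simp
  · conv_lhs => rw [h]
    rw [← mulVec_mulVec, mulVec_mulVec (M := Pᵀ), hP, one_mulVec, ← mulVec_mulVec, ← mulVec_smul]
    congr 1
    ext j
    by_cases hj : j = i <;> simp [mulVec_diagonal, hj]

/-- Half of Sylvester's law of inertia: on a subspace where `A - c` is negative definite, the
coordinates along the eigenvectors with eigenvalue below `c` determine the vector. -/
theorem finrank_le_card_eigenvalues_lt (hA : A.IsHermitian) {c : ℝ} (U : Submodule ℝ (V → ℝ))
    (hU : ∀ x ∈ U, x ≠ 0 → x ⬝ᵥ A *ᵥ x < c * (x ⬝ᵥ x)) :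
    Module.finrank ℝ U ≤ #{i | hA.eigenvalues i < c} := by
  obtain ⟨P, -, hq, hn⟩ := exists_coordinates hA
  set S : Finset V := {i | hA.eigenvalues i < c} with hS
  let φ : U →ₗ[ℝ] (S → ℝ) :=
    (LinearMap.funLeft ℝ ℝ (Subtype.val : S → V)).comp (Pᵀ.mulVecLin.comp U.subtype)
  have hφ : Function.Injective φ := by
    rw [← LinearMap.ker_eq_bot, LinearMap.ker_eq_bot']
    rintro ⟨x, hx⟩ hx0
    by_contra hne
    have := hU x hx fun h => hne (by simpa using h)
    rw [hq, hn, mul_sum] at this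
    refine absurd this (not_lt.2 (sum_le_sum fun i _ => ?_))
    by_cases hi : i ∈ S
    · have : (Pᵀ *ᵥ x) i = 0 := congr_fun hx0 ⟨i, hi⟩
      simp [this]
    · exact mul_le_mul_of_nonneg_right (by simpa [hS] using hi) (sq_nonneg _)
  simpa using LinearMap.finrank_le_finrank_of_injective hφ

/-- The other half of the law of inertia: the span of the eigenvectors with eigenvalue below `c`. -/
theorem exists_submodule_finrank_eq_card_eigenvalues_lt (hA : A.IsHermitian) (c : ℝ) :
    ∃ U : Submodule ℝ (V → ℝ), Module.finrank ℝ U = #{i | hA.eigenvalues i < c} ∧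
      ∀ x ∈ U, x ≠ 0 → x ⬝ᵥ A *ᵥ x < c * (x ⬝ᵥ x) := by
  obtain ⟨P, hP, hq, hn⟩ := exists_coordinates hA
  set S : Finset V := {i | hA.eigenvalues i < c} with hS
  let φ : (S → ℝ) →ₗ[ℝ] (V → ℝ) :=
    P.mulVecLin.comp (Function.ExtendByZero.linearMap ℝ (Subtype.val : S → V))
  have hco : ∀ y, Pᵀ *ᵥ φ y = Function.extend Subtype.val y 0 := fun y => by
    change Pᵀ *ᵥ (P *ᵥ _) = _
    rw [mulVec_mulVec, hP, one_mulVec]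
    rfl
  have hφ : Function.Injective φ := fun y z h => by
    have := congr_arg (Pᵀ *ᵥ ·) h
    simp only [hco] at this
    ext i
    simpa only [Subtype.val_injective.extend_apply] using congr_fun this i
  refine ⟨LinearMap.range φ, by simpa using LinearMap.finrank_range_of_inj hφ, ?_⟩
  rintro _ ⟨y, rfl⟩ hy
  have hsum : ∀ i, hA.eigenvalues i * (Pᵀ *ᵥ φ y) i ^ 2 ≤ c * (Pᵀ *ᵥ φ y) i ^ 2 := fun i => by
    by_cases hi : i ∈ S
    · exact mul_le_mul_of_nonneg_right (by simpa [hS] using hi : _ < c).le (sq_nonneg _)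
    · rw [hco, Function.extend_apply' _ _ _ (by simpa using hi)]; simp
  rw [hq, hn, mul_sum]
  refine sum_lt_sum (fun i _ => hsum i) ?_
  obtain ⟨i, hi⟩ : ∃ i, y i ≠ 0 := by
    by_contra! h
    exact hy (by rw [show y = 0 from funext h, map_zero])
  refine ⟨i, mem_univ _, ?_⟩
  rw [hco, Subtype.val_injective.extend_apply]
  have hlt : hA.eigenvalues i < c := (mem_filter.1 i.2).2
  exact mul_lt_mul_of_pos_right hlt (by positivity)

end Diagonalization

/-! ### Closed walks in subcubic graphs -/

section Walks

variable {V : Type*} [Fintype V] [DecidableEq V] (G : SimpleGraph V) [DecidableRel G.Adj]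

theorem trace_adjMatrix_sq : ((G.adjMatrix ℝ) ^ 2).trace = ∑ v, (G.degree v : ℝ) := by
  simp only [trace, sq, Matrix.diag_apply, SimpleGraph.adjMatrix_mul_self_apply_self]

omit [Fintype V] [DecidableEq V] in
theorem adjMatrix_nonneg (v w : V) : 0 ≤ G.adjMatrix ℝ v w := by
  rw [SimpleGraph.adjMatrix_apply]; split_ifs <;> simp

theorem trace_adjMatrix_cube_nonneg : 0 ≤ ((G.adjMatrix ℝ) ^ 3).trace := by
  refine sum_nonneg fun v _ => ?_
  simp only [diag_apply, pow_succ, pow_zero, Matrix.one_mul, Matrix.mul_apply]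
  exact sum_nonneg fun w _ => mul_nonneg (sum_nonneg fun u _ =>
    mul_nonneg (adjMatrix_nonneg G _ _) (adjMatrix_nonneg G _ _)) (adjMatrix_nonneg G _ _)

variable {G} in
theorem trace_adjMatrix_cube_eq_zero (hG : ∀ a b c, G.Adj a b → G.Adj b c → ¬ G.Adj c a) :
    ((G.adjMatrix ℝ) ^ 3).trace = 0 := by
  refine sum_eq_zero fun v _ => ?_
  simp only [diag_apply, pow_succ, pow_zero, Matrix.one_mul, Matrix.mul_apply]
  refine sum_eq_zero fun w _ => ?_
  rw [sum_mul]
  refine sum_eq_zero fun u _ => ?_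
  simp only [SimpleGraph.adjMatrix_apply]
  by_cases h₁ : G.Adj v u <;> by_cases h₂ : G.Adj u w <;> by_cases h₃ : G.Adj w v <;>
    simp [h₁, h₂, h₃]
  exact hG _ _ _ h₁ h₂ h₃

/-- The entries of `A²` are natural numbers, hence bounded by their squares. Counting the
closed walks of length four this way neglects the four-cycles only. -/
theorem le_trace_adjMatrix_pow_four :
    ∑ v, (2 * (G.degree v : ℝ) ^ 2 - G.degree v) ≤ ((G.adjMatrix ℝ) ^ 4).trace := by
  set A := G.adjMatrix ℝ with hA
  have hsymm : ∀ v w, (A ^ 2) v w = (A ^ 2) w v := fun v w => by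
    have : (A ^ 2)ᵀ = A ^ 2 := by rw [transpose_pow, hA, G.transpose_adjMatrix]
    exact (congr_fun (congr_fun this w) v)
  have hnat : ∀ v w, (A ^ 2) v w ≤ (A ^ 2) v w ^ 2 := fun v w => by
    rw [hA, G.adjMatrix_pow_apply_eq_card_walk]
    exact_mod_cast Nat.le_self_pow two_ne_zero _
  have hdiag : ∀ v, (A ^ 2) v v = G.degree v := fun v => by
    rw [sq, hA, SimpleGraph.adjMatrix_mul_self_apply_self]
  have htr : (A ^ 4).trace = ∑ v, ∑ w, (A ^ 2) v w ^ 2 := by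
    rw [show A ^ 4 = A ^ 2 * A ^ 2 by rw [← pow_add]]
    simp only [trace, diag_apply, Matrix.mul_apply]
    exact sum_congr rfl fun v _ => sum_congr rfl fun w _ => by rw [hsymm w v, sq ((A ^ 2) v w)]
  have hsum : ∑ v, ∑ w, (A ^ 2) v w = ∑ v, (G.degree v : ℝ) ^ 2 := by
    have hdeg : ∀ v, ∑ w, A v w = G.degree v := fun v => by
      simp [hA, SimpleGraph.adjMatrix_apply, ← SimpleGraph.card_neighborFinset_eq_degree,
        SimpleGraph.neighborFinset_eq_filter]
    have hdeg' : ∀ v, ∑ w, A w v = G.degree v := fun v => by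
      rw [← hdeg]
      exact sum_congr rfl fun w _ => by simp [hA, SimpleGraph.adjMatrix_apply, G.adj_comm]
    calc ∑ v, ∑ w, (A ^ 2) v w = ∑ v, ∑ w, ∑ u, A v u * A u w := by
          simp only [sq, Matrix.mul_apply]
      _ = ∑ v, ∑ u, A v u * G.degree u :=
          sum_congr rfl fun v _ => by rw [sum_comm]; simp only [← mul_sum, hdeg]
      _ = _ := by rw [sum_comm]; simp only [← sum_mul, hdeg', sq]
  rw [htr]
  have hrow : ∀ v, (G.degree v : ℝ) ^ 2 - G.degree v + ∑ w, (A ^ 2) v w ≤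
      ∑ w, (A ^ 2) v w ^ 2 := fun v => by
    rw [← add_sum_erase _ _ (mem_univ v), ← add_sum_erase (a := v) univ _ (mem_univ v), hdiag]
    have := sum_le_sum fun w (_ : w ∈ univ.erase v) => hnat v w
    linarith
  calc _ = ∑ v, ((G.degree v : ℝ) ^ 2 - G.degree v + ∑ w, (A ^ 2) v w) := by
        rw [sum_add_distrib, hsum, ← sum_add_distrib]
        exact sum_congr rfl fun v _ => by ring
    _ ≤ _ := sum_le_sum fun v _ => hrow v

variable {G}

theorem abs_eigenvalues_adjMatrix_le {d : ℕ} (hd : ∀ v, G.degree v ≤ d) (i : V) :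
    |(G.isHermitian_adjMatrix (R := ℝ)).eigenvalues i| ≤ d := by
  obtain ⟨x, hx, hAx⟩ := exists_eigenvector (G.isHermitian_adjMatrix (R := ℝ)) i
  have : Nonempty V := ⟨i⟩
  obtain ⟨v, -, hv⟩ := exists_max_image univ (fun w => |x w|) univ_nonempty
  have hv0 : 0 < |x v| := by
    by_contra! h
    have : x = 0 := funext fun w => abs_nonpos_iff.1 ((hv w (mem_univ w)).trans h)
    simp [this] at hx
  have h := congr_arg abs (congr_fun hAx v)
  rw [SimpleGraph.adjMatrix_mulVec_apply, Pi.smul_apply, smul_eq_mul, abs_mul] at h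
  refine le_of_mul_le_mul_right ?_ hv0
  rw [← h]
  calc |∑ w ∈ G.neighborFinset v, x w| ≤ ∑ w ∈ G.neighborFinset v, |x w| := abs_sum_le_sum_abs _ _
    _ ≤ ∑ w ∈ G.neighborFinset v, |x v| := sum_le_sum fun w _ => hv w (mem_univ w)
    _ = G.degree v * |x v| := by simp
    _ ≤ d * |x v| := by gcongr; exact hd v

/-- The common part of the two applications of `two_mul_card_sqrt_two_lt`: the spectrum of a
subcubic graph or of its negative satisfies the hypotheses on the second and fourth moments. -/
theorem moments_adjMatrix (hd : ∀ v, G.degree v ≤ 3) :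
    ∑ i, (G.isHermitian_adjMatrix (R := ℝ)).eigenvalues i ^ 2 ≤ 3 * Fintype.card V ∧
    0 ≤ ∑ i, ((G.isHermitian_adjMatrix (R := ℝ)).eigenvalues i ^ 4
      - 11 * (G.isHermitian_adjMatrix (R := ℝ)).eigenvalues i ^ 2 + 18) := by
  have h2 := trace_pow_eq_sum_eigenvalues_pow (G.isHermitian_adjMatrix (R := ℝ)) 2
  have h4 := trace_pow_eq_sum_eigenvalues_pow (G.isHermitian_adjMatrix (R := ℝ)) 4
  rw [trace_adjMatrix_sq] at h2
  constructor
  · rw [← h2]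
    calc ∑ v, (G.degree v : ℝ) ≤ ∑ _v : V, (3 : ℝ) :=
          sum_le_sum fun v _ => by exact_mod_cast hd v
      _ = _ := by simp [mul_comm]
  · rw [sum_add_distrib, sum_sub_distrib, ← mul_sum, ← h2, ← h4]
    have hw := le_trace_adjMatrix_pow_four G
    have : 0 ≤ ∑ v, 2 * ((G.degree v : ℝ) - 3) ^ 2 := sum_nonneg fun v _ => by positivity
    have h : ∑ v, 2 * ((G.degree v : ℝ) - 3) ^ 2 = ∑ v, (2 * (G.degree v : ℝ) ^ 2 - G.degree v)
        - 11 * ∑ v, (G.degree v : ℝ) + ∑ _v : V, (18 : ℝ) := by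
      rw [mul_sum, ← sum_sub_distrib, ← sum_add_distrib]
      exact sum_congr rfl fun v _ => by ring
    linarith

theorem two_mul_card_eigenvalues_gt [Nonempty V] (hd : ∀ v, G.degree v ≤ 3) :
    2 * #{i | √2 < (G.isHermitian_adjMatrix (R := ℝ)).eigenvalues i} < Fintype.card V := by
  have hb := fun i => abs_le.1 (abs_eigenvalues_adjMatrix_le hd i)
  obtain ⟨h2, h4⟩ := moments_adjMatrix hd
  refine two_mul_card_sqrt_two_lt _ (fun i => by simpa using (hb i).1)
    (fun i => by simpa using (hb i).2) ?_ h2 ?_ h4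
  · simpa using (trace_pow_eq_sum_eigenvalues_pow (G.isHermitian_adjMatrix (R := ℝ)) 1).symm
  · rw [← trace_pow_eq_sum_eigenvalues_pow]
    exact trace_adjMatrix_cube_nonneg G

theorem two_mul_card_eigenvalues_lt_of_triangleFree [Nonempty V] (hd : ∀ v, G.degree v ≤ 3)
    (hG : ∀ a b c, G.Adj a b → G.Adj b c → ¬ G.Adj c a) :
    2 * #{i | (G.isHermitian_adjMatrix (R := ℝ)).eigenvalues i < -√2} < Fintype.card V := by
  have hb := fun i => abs_le.1 (abs_eigenvalues_adjMatrix_le hd i)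
  obtain ⟨h2, h4⟩ := moments_adjMatrix hd
  have h := two_mul_card_sqrt_two_lt (fun i => -(G.isHermitian_adjMatrix (R := ℝ)).eigenvalues i)
    (fun i => by simpa using (hb i).2) (fun i => by simpa [neg_le] using (hb i).1) ?_
    (by simpa using h2) ?_ (by simpa [Even.neg_pow (show Even 4 by decide)] using h4)
  · simpa only [lt_neg] using h
  · simpa using (trace_pow_eq_sum_eigenvalues_pow (G.isHermitian_adjMatrix (R := ℝ)) 1).symm
  · simp only [Odd.neg_pow (show Odd 3 by decide), sum_neg_distrib,
      ← trace_pow_eq_sum_eigenvalues_pow, trace_adjMatrix_cube_eq_zero hG, neg_zero, le_refl]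

end Walks

/-! ### Positions in the ordered spectrum -/

section Positions

variable {V : Type*} [Fintype V] [DecidableEq V] {G : SimpleGraph V} [DecidableRel G.Adj]

theorem card_eigenvalues_eq_card_eigenvalues₀ {A : Matrix V V ℝ} (hA : A.IsHermitian)
    (p : ℝ → Prop) [DecidablePred p] :
    #{i | p (hA.eigenvalues i)} = #{j | p (hA.eigenvalues₀ j)} :=
  card_equiv (Fintype.equivOfCardEq (Fintype.card_fin _)).symm fun i => by
    rw [mem_filter, mem_filter]; simp [IsHermitian.eigenvalues]

theorem le_card_eigenvalues_gt {c : ℝ} {i : ℕ} {hi : 1 ≤ i ∧ i ≤ Fintype.card V}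
    (h : c < eig G i hi) :
    i ≤ #{v | c < (G.isHermitian_adjMatrix (R := ℝ)).eigenvalues v} := by
  rw [card_eigenvalues_eq_card_eigenvalues₀ _ (c < ·)]
  have hsub : Iic (⟨i - 1, by omega⟩ : Fin (Fintype.card V)) ⊆
      univ.filter (c < (G.isHermitian_adjMatrix (R := ℝ)).eigenvalues₀ ·) := fun j hj => by
    rw [mem_filter]
    exact ⟨mem_univ _, h.trans_le (IsHermitian.eigenvalues₀_antitone _ (mem_Iic.1 hj))⟩
  have := card_le_card hsub
  rw [Fin.card_Iic] at this
  simp only at this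
  omega

theorem le_card_eigenvalues_lt {c : ℝ} {i : ℕ} {hi : 1 ≤ i ∧ i ≤ Fintype.card V}
    (h : eig G i hi < c) :
    Fintype.card V + 1 - i ≤ #{v | (G.isHermitian_adjMatrix (R := ℝ)).eigenvalues v < c} := by
  rw [card_eigenvalues_eq_card_eigenvalues₀ _ (· < c)]
  have hsub : Ici (⟨i - 1, by omega⟩ : Fin (Fintype.card V)) ⊆
      univ.filter ((G.isHermitian_adjMatrix (R := ℝ)).eigenvalues₀ · < c) := fun j hj => by
    rw [mem_filter]
    exact ⟨mem_univ _, (IsHermitian.eigenvalues₀_antitone _ (mem_Ici.1 hj)).trans_lt h⟩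
  have := card_le_card hsub
  rw [Fin.card_Ici] at this
  simp only at this
  omega

end Positions

/-! ### Deletion of triangles -/

section Triangles

variable {V : Type*} [Fintype V] [DecidableEq V] {G : SimpleGraph V} [DecidableRel G.Adj]

omit [DecidableEq V] in
theorem quadraticForm_eq_sum (x : V → ℝ) :
    x ⬝ᵥ G.adjMatrix ℝ *ᵥ x = ∑ v, ∑ w, x v * (G.adjMatrix ℝ v w * x w) := by
  simp only [dotProduct, mulVec, mul_sum]

omit [DecidableEq V] in
theorem quadraticForm_add (x y : V → ℝ) :
    (x + y) ⬝ᵥ G.adjMatrix ℝ *ᵥ (x + y) = x ⬝ᵥ G.adjMatrix ℝ *ᵥ x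
      + 2 * (x ⬝ᵥ G.adjMatrix ℝ *ᵥ y) + y ⬝ᵥ G.adjMatrix ℝ *ᵥ y := by
  have : y ⬝ᵥ G.adjMatrix ℝ *ᵥ x = x ⬝ᵥ G.adjMatrix ℝ *ᵥ y := by
    rw [dotProduct_mulVec, ← mulVec_transpose, G.transpose_adjMatrix, dotProduct_comm]
  rw [mulVec_add, add_dotProduct, dotProduct_add, dotProduct_add, this]
  ring

theorem sum_eq_of_support_triple {a b c : V} (hab : a ≠ b) (hbc : b ≠ c) (hca : c ≠ a)
    {f : V → ℝ} (hf : ∀ v, v ≠ a → v ≠ b → v ≠ c → f v = 0) : ∑ v, f v = f a + f b + f c := by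
  rw [← sum_subset (subset_univ {a, b, c}) fun v _ hv => ?_, sum_insert, sum_pair hbc, add_assoc]
  · simp [hab, hca.symm]
  · simp only [mem_insert, mem_singleton, not_or] at hv
    exact hf v hv.1 hv.2.1 hv.2.2

theorem dotProduct_self_of_support_triple {a b c : V} (hab : a ≠ b) (hbc : b ≠ c) (hca : c ≠ a)
    {x : V → ℝ} (hx : ∀ v, v ≠ a → v ≠ b → v ≠ c → x v = 0) :
    x ⬝ᵥ x = x a ^ 2 + x b ^ 2 + x c ^ 2 := by
  rw [dotProduct, sum_eq_of_support_triple hab hbc hca fun v h₁ h₂ h₃ => by simp [hx v h₁ h₂ h₃]]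
  ring

/-- On vectors supported on a triangle, the adjacency matrix is the all-ones matrix minus the
identity. -/
theorem quadraticForm_of_support_triangle {a b c : V} (hab : G.Adj a b) (hbc : G.Adj b c)
    (hca : G.Adj c a) {x : V → ℝ} (hx : ∀ v, v ≠ a → v ≠ b → v ≠ c → x v = 0) :
    x ⬝ᵥ G.adjMatrix ℝ *ᵥ x = (x a + x b + x c) ^ 2 - x ⬝ᵥ x := by
  rw [dotProduct_self_of_support_triple hab.ne hbc.ne hca.ne hx, dotProduct,
    sum_eq_of_support_triple hab.ne hbc.ne hca.ne fun v h₁ h₂ h₃ => by simp [hx v h₁ h₂ h₃]]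
  have h : ∀ v, (G.adjMatrix ℝ *ᵥ x) v = G.adjMatrix ℝ v a * x a + G.adjMatrix ℝ v b * x b
      + G.adjMatrix ℝ v c * x c := fun v => by
    rw [mulVec, dotProduct]
    exact sum_eq_of_support_triple hab.ne hbc.ne hca.ne fun v h₁ h₂ h₃ => by
      simp [hx v h₁ h₂ h₃]
  simp only [h, SimpleGraph.adjMatrix_apply, hab, hbc, hca, hab.symm, hbc.symm, hca.symm,
    SimpleGraph.irrefl, if_true, if_false]
  ring

/-- A vertex of degree at most three in a triangle has at most one neighbor outside it. -/
theorem card_neighbors_outside_triangle_le_one (hd : ∀ v, G.degree v ≤ 3) {a b c : V}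
    (hab : G.Adj a b) (hca : G.Adj c a) (hbc : b ≠ c) {X : Finset V} (hb : b ∉ X) (hc : c ∉ X) :
    #{v ∈ X | G.Adj a v} ≤ 1 := by
  have hsub : insert b (insert c {v ∈ X | G.Adj a v}) ⊆ G.neighborFinset a := by
    intro v hv
    simp only [mem_insert, mem_filter] at hv
    rw [SimpleGraph.mem_neighborFinset]
    rcases hv with rfl | rfl | hv
    exacts [hab, hca.symm, hv.2]
  have := card_le_card hsub
  rw [card_insert_of_notMem (by simp [hb, hbc]), card_insert_of_notMem (by simp [hc]),
    G.card_neighborFinset_eq_degree] at this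
  have := hd a
  omega

omit [DecidableEq V] in
/-- Vectors supported on `S` see only the subgraph induced on `S`. -/
theorem quadraticForm_induce {S : Finset V} {x : V → ℝ} (hx : ∀ v ∉ S, x v = 0) :
    (fun v : S => x v) ⬝ᵥ (G.induce (S : Set V)).adjMatrix ℝ *ᵥ (fun v : S => x v)
      = x ⬝ᵥ G.adjMatrix ℝ *ᵥ x := by
  rw [quadraticForm_eq_sum, quadraticForm_eq_sum]
  have h : ∀ f : V → ℝ, (∀ v ∉ S, f v = 0) → ∑ v : S, f v = ∑ v, f v := fun f hf => by
    rw [sum_coe_sort S f]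
    exact sum_subset (subset_univ S) fun v _ hv => hf v hv
  rw [← h _ fun v hv => by simp [hx v hv]]
  refine sum_congr rfl fun v _ => ?_
  rw [← h _ fun v hv => by simp [hx v hv]]
  rfl

theorem two_mul_finrank_lt_of_triangleFree (hd : ∀ v, G.degree v ≤ 3) {S : Finset V}
    (hS : S.Nonempty) (hG : ∀ a ∈ S, ∀ b ∈ S, ∀ c ∈ S, G.Adj a b → G.Adj b c → ¬ G.Adj c a)
    (U : Submodule ℝ (V → ℝ)) (hU : ∀ x ∈ U, ∀ v ∉ S, x v = 0)
    (hneg : ∀ x ∈ U, x ≠ 0 → x ⬝ᵥ G.adjMatrix ℝ *ᵥ x < -√2 * (x ⬝ᵥ x)) :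
    2 * Module.finrank ℝ U < #S := by
  let ρ : (V → ℝ) →ₗ[ℝ] (S → ℝ) := LinearMap.funLeft ℝ ℝ Subtype.val
  have hinj : Function.Injective (ρ.domRestrict U) := by
    rw [← LinearMap.ker_eq_bot, LinearMap.ker_eq_bot']
    rintro ⟨x, hx⟩ hx0
    ext v
    by_cases hv : v ∈ S
    · exact congr_fun hx0 ⟨v, hv⟩
    · exact hU x hx v hv
  have : Nonempty S := hS.to_subtype
  have hd' : ∀ v, (G.induce (S : Set V)).degree v ≤ 3 := fun v => by
    refine le_trans ?_ (hd v)
    rw [← SimpleGraph.card_neighborFinset_eq_degree, ← SimpleGraph.card_neighborFinset_eq_degree]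
    refine card_le_card_of_injOn Subtype.val (fun w hw => ?_) Subtype.val_injective.injOn
    simpa using hw
  have h₁ := two_mul_card_eigenvalues_lt_of_triangleFree hd'
    fun a b c => hG a a.2 b b.2 c c.2
  have h₂ := finrank_le_card_eigenvalues_lt ((G.induce (S : Set V)).isHermitian_adjMatrix (R := ℝ))
    (c := -√2) (LinearMap.range (ρ.domRestrict U)) ?_
  · have h₃ := (LinearMap.finrank_range_of_inj hinj).symm.le.trans h₂
    have h₄ : Fintype.card ↑(S : Set V) = #S := by simp
    omega
  · rintro _ ⟨⟨x, hx⟩, rfl⟩ hx0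
    have := hneg x hx fun h => hx0 (by ext v; simp [h])
    rw [← quadraticForm_induce (hU x hx)] at this
    refine this.trans_eq ?_
    congr 1
    rw [dotProduct, dotProduct, ← sum_subset (subset_univ S) fun v _ hv => by simp [hU x hx v hv],
      ← sum_coe_sort]
    rfl

theorem finrank_le_add_finrank_inf_ker {E F : Type*} [AddCommGroup E] [Module ℝ E]
    [FiniteDimensional ℝ E] [AddCommGroup F] [Module ℝ F] [FiniteDimensional ℝ F]
    (U : Submodule ℝ E) (φ : E →ₗ[ℝ] F) :
    Module.finrank ℝ U ≤ Module.finrank ℝ F +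
      Module.finrank ℝ (U ⊓ LinearMap.ker φ : Submodule ℝ E) := by
  have h := (φ.domRestrict U).finrank_range_add_finrank_ker
  have h₁ := Submodule.finrank_le (LinearMap.range (φ.domRestrict U))
  have h₂ : Module.finrank ℝ (LinearMap.ker (φ.domRestrict U))
      = Module.finrank ℝ (U ⊓ LinearMap.ker φ : Submodule ℝ E) := by
    rw [LinearMap.ker_domRestrict, ← Submodule.map_comap_subtype,
      Submodule.finrank_map_subtype_eq]
  omega

end Triangles

section Key

variable {V : Type*} [Fintype V] [DecidableEq V] {G : SimpleGraph V} [DecidableRel G.Adj]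

/-- A vector that is constant on the three outside neighbors of a triangle, and zero elsewhere
outside the triangle, does not make the quadratic form of `A + √2` negative. -/
theorem neg_sqrt_two_mul_le_of_const_on_pendants {a b c : V} (hab : G.Adj a b) (hbc : G.Adj b c)
    (hca : G.Adj c a) {X : Finset V} (haX : a ∉ X) (hbX : b ∉ X) (hcX : c ∉ X) (hX : #X = 3)
    (ha : #{v ∈ X | G.Adj a v} = 1) (hb : #{v ∈ X | G.Adj b v} = 1)
    (hc : #{v ∈ X | G.Adj c v} = 1) {t : V → ℝ} (ht : ∀ v, v ≠ a → v ≠ b → v ≠ c → t v = 0)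
    (s : ℝ) {x : V → ℝ} (hx : x = t + fun v => if v ∈ X then s else 0) :
    -√2 * (x ⬝ᵥ x) ≤ x ⬝ᵥ G.adjMatrix ℝ *ᵥ x := by
  set y : V → ℝ := fun v => if v ∈ X then s else 0 with hy
  obtain ⟨hl, -⟩ := sqrt_two_bounds
  have hyy : y ⬝ᵥ y = 3 * s ^ 2 := by
    simp [dotProduct, hy, hX]; ring
  have hty : t ⬝ᵥ y = 0 := by
    rw [dotProduct, sum_eq_of_support_triple hab.ne hbc.ne hca.ne fun v h₁ h₂ h₃ => by
      simp [ht v h₁ h₂ h₃]]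
    simp [hy, haX, hbX, hcX]
  have hxx : x ⬝ᵥ x = t ⬝ᵥ t + 3 * s ^ 2 := by
    rw [hx, add_dotProduct, dotProduct_add, dotProduct_add, dotProduct_comm y t, hty, hyy]
    ring
  have hAy : ∀ v, (G.adjMatrix ℝ *ᵥ y) v = #{w ∈ X | G.Adj v w} * s := fun v => by
    rw [SimpleGraph.adjMatrix_mulVec_apply, ← sum_filter, sum_const, nsmul_eq_mul]
    congr 3
    ext w
    simp [and_comm]
  have htAy : t ⬝ᵥ G.adjMatrix ℝ *ᵥ y = (t a + t b + t c) * s := by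
    rw [dotProduct, sum_eq_of_support_triple hab.ne hbc.ne hca.ne fun v h₁ h₂ h₃ => by
      simp [ht v h₁ h₂ h₃]]
    rw [hAy, hAy, hAy, ha, hb, hc]
    push_cast; ring
  have hyAy : 0 ≤ y ⬝ᵥ G.adjMatrix ℝ *ᵥ y := by
    refine sum_nonneg fun v _ => ?_
    rw [hAy]
    simp only [hy]
    split_ifs
    · rw [mul_left_comm]; exact mul_nonneg (Nat.cast_nonneg _) (mul_self_nonneg s)
    · simp
  rw [hxx, hx, quadraticForm_add, quadraticForm_of_support_triangle hab hbc hca ht, htAy]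
  have h0 : 0 ≤ t ⬝ᵥ t := sum_nonneg fun v _ => mul_self_nonneg _
  nlinarith [sq_nonneg (t a + t b + t c + s), sq_nonneg s,
    mul_nonneg (sub_nonneg.2 hl.le) h0, mul_nonneg (sub_nonneg.2 hl.le) (sq_nonneg s)]

/-- A subspace of vectors supported on `S` on which the form of `A + √2` is negative definite has
dimension less than `|S| / 2`. The proof deletes triangles together with their neighbors: with `X`
the set of outside neighbors of a triangle, forcing the vectors to vanish on `X` costs at most
`|X| ≤ 3` dimensions and separates the triangle, on which the form is positive, from the rest,
which has `3 + |X| ≥ 2 |X|` fewer vertices. -/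
theorem two_mul_finrank_lt (hd : ∀ v, G.degree v ≤ 3) (S : Finset V) :
    S.Nonempty → ∀ U : Submodule ℝ (V → ℝ), (∀ x ∈ U, ∀ v ∉ S, x v = 0) →
      (∀ x ∈ U, x ≠ 0 → x ⬝ᵥ G.adjMatrix ℝ *ᵥ x < -√2 * (x ⬝ᵥ x)) →
      2 * Module.finrank ℝ U < #S := by
  induction S using Finset.strongInduction with
  | H S ih =>
  intro hS U hU hneg
  by_cases hG : ∀ a ∈ S, ∀ b ∈ S, ∀ c ∈ S, G.Adj a b → G.Adj b c → ¬ G.Adj c a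
  · exact two_mul_finrank_lt_of_triangleFree hd hS hG U hU hneg
  push Not at hG
  obtain ⟨a, haS, b, hbS, c, hcS, hab, hbc, hca⟩ := hG
  set T : Finset V := {a, b, c} with hT
  have hTcard : #T = 3 := card_eq_three.2 ⟨a, b, c, hab.ne, hca.ne', hbc.ne, rfl⟩
  have hTS : T ⊆ S := by
    intro v hv
    simp only [hT, mem_insert, mem_singleton] at hv
    rcases hv with rfl | rfl | rfl <;> assumption
  set X : Finset V := {v ∈ S \ T | G.Adj a v ∨ G.Adj b v ∨ G.Adj c v} with hX
  have hXS : X ⊆ S \ T := filter_subset _ _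
  have hTX : ∀ v ∈ T, v ∉ X := fun v hv hv' => (mem_sdiff.1 (hXS hv')).2 hv
  have haX : a ∉ X := hTX a (by simp [hT])
  have hbX : b ∉ X := hTX b (by simp [hT])
  have hcX : c ∉ X := hTX c (by simp [hT])
  have hna := card_neighbors_outside_triangle_le_one hd hab hca hbc.ne hbX hcX
  have hnb := card_neighbors_outside_triangle_le_one hd hbc hab hca.ne hcX haX
  have hnc := card_neighbors_outside_triangle_le_one hd hca hbc hab.ne haX hbX
  have hXle : #X ≤ #{v ∈ X | G.Adj a v} + #{v ∈ X | G.Adj b v} + #{v ∈ X | G.Adj c v} := by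
    refine le_trans (card_le_card fun v hv => ?_)
      ((card_union_le _ _).trans (Nat.add_le_add_right (card_union_le _ _) _))
    have := (mem_filter.1 hv).2
    simp only [mem_union, mem_filter, hv, true_and]
    tauto
  set R : Finset V := (S \ T) \ X with hR
  have hcard : #S = 3 + #X + #R := by
    have h₁ := card_sdiff_add_card_eq_card hTS
    have h₂ := card_sdiff_add_card_eq_card hXS
    rw [← hR] at h₂
    omega
  have hRS : R ⊂ S := (ssubset_iff_of_subset (sdiff_subset.trans sdiff_subset)).2
    ⟨a, haS, by simp [hT]⟩
  rcases R.eq_empty_or_nonempty with hR0 | hR0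
  · -- `S` consists of the triangle and its neighbors
    have hST : ∀ v ∉ X, v ∉ T → v ∉ S := fun v hvX hvT hvS => by
      have : v ∈ R := by simp [hR, hvX, hvT, hvS]
      simp [hR0] at this
    rw [hR0, card_empty] at hcard
    rcases (show #X < 3 ∨ #X = 3 by omega) with hX3 | hX3
    · have hker := finrank_le_add_finrank_inf_ker U
        (LinearMap.funLeft ℝ ℝ (Subtype.val : X → V))
      have hbot : U ⊓ LinearMap.ker (LinearMap.funLeft ℝ ℝ (Subtype.val : X → V)) = ⊥ := by
        rw [eq_bot_iff]
        rintro x ⟨hxU, hxX⟩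
        by_contra hx0
        have hlt := hneg x hxU hx0
        rw [quadraticForm_of_support_triangle hab hbc hca fun v h₁ h₂ h₃ => ?_] at hlt
        · have : 0 ≤ x ⬝ᵥ x := sum_nonneg fun v _ => mul_self_nonneg _
          nlinarith [sqrt_two_bounds.1, sq_nonneg (x a + x b + x c)]
        · by_cases hv : v ∈ X
          · exact congr_fun (LinearMap.mem_ker.1 hxX) ⟨v, hv⟩
          · exact hU x hxU v (hST v hv (by simp [hT, h₁, h₂, h₃]))
      rw [hbot, finrank_bot] at hker
      simp only [Module.finrank_fintype_fun_eq_card, Fintype.card_coe] at hker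
      omega
    · -- here `2 |X| = |S|`, and requiring `x` to be constant on `X` saves one dimension
      obtain ⟨p, q, r, -, -, -, hpqr⟩ := card_eq_three.1 hX3
      let φ : (V → ℝ) →ₗ[ℝ] ℝ × ℝ :=
        ((LinearMap.proj p : (V → ℝ) →ₗ[ℝ] ℝ) - LinearMap.proj q).prod
          ((LinearMap.proj p : (V → ℝ) →ₗ[ℝ] ℝ) - LinearMap.proj r)
      have hker := finrank_le_add_finrank_inf_ker U φ
      have hbot : U ⊓ LinearMap.ker φ = ⊥ := by
        rw [eq_bot_iff]
        rintro x ⟨hxU, hxX⟩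
        by_contra hx0
        have hφ : φ x = (x p - x q, x p - x r) := rfl
        have hxX' := LinearMap.mem_ker.1 hxX
        rw [hφ, Prod.mk_eq_zero, sub_eq_zero, sub_eq_zero] at hxX'
        have hconst : ∀ v ∈ X, x v = x p := fun v hv => by
          rw [hpqr] at hv
          simp only [mem_insert, mem_singleton] at hv
          rcases hv with rfl | rfl | rfl
          exacts [rfl, hxX'.1.symm, hxX'.2.symm]
        refine absurd (hneg x hxU hx0) (not_lt.2 ?_)
        refine neg_sqrt_two_mul_le_of_const_on_pendants hab hbc hca haX hbX hcX hX3
          (by omega) (by omega) (by omega) (t := fun v => if v ∈ T then x v else 0)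
          (fun v h₁ h₂ h₃ => by simp [hT, h₁, h₂, h₃]) (x p) (funext fun v => ?_)
        by_cases hvT : v ∈ T
        · simp [hvT, hTX v hvT]
        · by_cases hvX : v ∈ X
          · simp [hvT, hvX, hconst v hvX]
          · simp [hvT, hvX, hU x hxU v (hST v hvX hvT)]
      rw [hbot, finrank_bot] at hker
      simp only [Module.finrank_prod, Module.finrank_self] at hker
      omega
  · set K := U ⊓ LinearMap.ker (LinearMap.funLeft ℝ ℝ (Subtype.val : X → V)) with hK
    have hker := finrank_le_add_finrank_inf_ker U (LinearMap.funLeft ℝ ℝ (Subtype.val : X → V))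
    rw [← hK] at hker
    simp only [Module.finrank_fintype_fun_eq_card, Fintype.card_coe] at hker
    let ρ : (V → ℝ) →ₗ[ℝ] (V → ℝ) :=
      { toFun := fun x v => if v ∈ R then x v else 0
        map_add' := fun x y => by ext v; by_cases h : v ∈ R <;> simp [h]
        map_smul' := fun r x => by ext v; by_cases h : v ∈ R <;> simp [h] }
    have hρ : ∀ x v, ρ x v = if v ∈ R then x v else 0 := fun x v => rfl
    -- the restriction to `R` of a nonzero vector of `K` is again a negative vector
    have hneg' : ∀ x ∈ K, x ≠ 0 →
        ρ x ⬝ᵥ G.adjMatrix ℝ *ᵥ ρ x < -√2 * (ρ x ⬝ᵥ ρ x) := fun x hx hx0 => by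
      have hlt := hneg x hx.1 hx0
      set t : V → ℝ := fun v => if v ∈ T then x v else 0 with ht
      have hts : ∀ v, v ≠ a → v ≠ b → v ≠ c → t v = 0 := fun v h₁ h₂ h₃ => by
        simp [ht, hT, h₁, h₂, h₃]
      have hdisj : ∀ v ∈ T, v ∉ R := fun v hv h => (mem_sdiff.1 (mem_sdiff.1 h).1).2 hv
      have hsplit : x = t + ρ x := funext fun v => by
        rw [Pi.add_apply, hρ]
        by_cases hvT : v ∈ T
        · simp [ht, hvT, hdisj v hvT]
        · by_cases hvR : v ∈ R
          · simp [ht, hvT, hvR]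
          · rw [if_neg hvR]
            simp only [ht, if_neg hvT, add_zero]
            by_cases hvX : v ∈ X
            · exact congr_fun (LinearMap.mem_ker.1 hx.2) ⟨v, hvX⟩
            · exact hU x hx.1 v fun hvS => hvR (by simp [hR, hvS, hvT, hvX])
      have htρ : t ⬝ᵥ ρ x = 0 := sum_eq_zero fun v _ => by
        rw [hρ]
        by_cases hvT : v ∈ T
        · simp [hdisj v hvT]
        · simp [ht, hvT]
      have hcross : t ⬝ᵥ G.adjMatrix ℝ *ᵥ ρ x = 0 := sum_eq_zero fun v _ => by
        by_cases hvT : v ∈ T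
        · rw [SimpleGraph.adjMatrix_mulVec_apply, sum_eq_zero, mul_zero]
          intro w hw
          rw [SimpleGraph.mem_neighborFinset] at hw
          rw [hρ, if_neg fun hwR => ?_]
          refine (mem_sdiff.1 hwR).2 (mem_filter.2 ⟨(mem_sdiff.1 hwR).1, ?_⟩)
          simp only [hT, mem_insert, mem_singleton] at hvT
          rcases hvT with rfl | rfl | rfl <;> tauto
        · simp [ht, hvT]
      have hxx : x ⬝ᵥ x = t ⬝ᵥ t + ρ x ⬝ᵥ ρ x := by
        conv_lhs => rw [hsplit]
        rw [add_dotProduct, dotProduct_add, dotProduct_add, dotProduct_comm (ρ x) t, htρ]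
        ring
      have hxAx : x ⬝ᵥ G.adjMatrix ℝ *ᵥ x
          = t ⬝ᵥ G.adjMatrix ℝ *ᵥ t + ρ x ⬝ᵥ G.adjMatrix ℝ *ᵥ ρ x := by
        conv_lhs => rw [hsplit]
        rw [quadraticForm_add, hcross]
        ring
      rw [hxx, hxAx, quadraticForm_of_support_triangle hab hbc hca hts] at hlt
      have : 0 ≤ t ⬝ᵥ t := sum_nonneg fun v _ => mul_self_nonneg _
      nlinarith [sqrt_two_bounds.1, sq_nonneg (t a + t b + t c)]
    have hinj : Function.Injective (ρ.domRestrict K) := by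
      rw [← LinearMap.ker_eq_bot, LinearMap.ker_eq_bot']
      rintro ⟨x, hx⟩ hx0
      by_contra hne
      have := hneg' x hx fun h => hne (by simpa using h)
      rw [show ρ x = 0 from hx0] at this
      simp at this
    have hIH := ih R hRS hR0 (LinearMap.range (ρ.domRestrict K))
      (by rintro _ ⟨x, rfl⟩ v hv; exact if_neg hv) (by
        rintro _ ⟨⟨x, hx⟩, rfl⟩ hx0
        exact hneg' x hx fun h => hx0 (by simp [h]))
    rw [LinearMap.finrank_range_of_inj hinj] at hIH
    omega

theorem two_mul_card_eigenvalues_lt [Nonempty V] (hd : ∀ v, G.degree v ≤ 3) :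
    2 * #{i | (G.isHermitian_adjMatrix (R := ℝ)).eigenvalues i < -√2} < Fintype.card V := by
  obtain ⟨U, hU, hneg⟩ := exists_submodule_finrank_eq_card_eigenvalues_lt
    (G.isHermitian_adjMatrix (R := ℝ)) (-√2)
  rw [← hU]
  exact two_mul_finrank_lt hd univ univ_nonempty U (fun x _ v hv => absurd (mem_univ v) hv) hneg

end Key

/-! ### The Heawood graph -/

/-- The Heawood graph, as the incidence graph of the Fano plane: the points `(false, i)` and the
lines `(true, j)` are indexed by the integers modulo `7`, and `(false, i)` lies on `(true, j)` when
`j - i` belongs to the perfect difference set `{0, 1, 3}`. -/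
def heawood : SimpleGraph (Bool × Fin 7) :=
  SimpleGraph.fromRel fun u v => u.1 = false ∧ v.1 = true ∧ v.2 - u.2 ∈ ({0, 1, 3} : Finset (Fin 7))

instance : DecidableRel heawood.Adj :=
  fun u v => decidable_of_iff _ (SimpleGraph.fromRel_adj _ u v).symm

theorem heawood_degree : ∀ v, heawood.degree v = 3 := by decide +kernel

/-- Two points lie on exactly one common line, and dually. -/
theorem heawood_card_common : ∀ v w, #{u | heawood.Adj v u ∧ heawood.Adj u w} =
    (if v = w then 2 else 0) + if v.1 = w.1 then 1 else 0 := by decide +kernel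

theorem heawood_adjMatrix_mulVec_mulVec (x : Bool × Fin 7 → ℝ) (v : Bool × Fin 7) :
    (heawood.adjMatrix ℝ *ᵥ heawood.adjMatrix ℝ *ᵥ x) v = 2 * x v + ∑ i, x (v.1, i) := by
  have hsq : ∀ w, (heawood.adjMatrix ℝ * heawood.adjMatrix ℝ) v w =
      (if v = w then 2 else 0) + if v.1 = w.1 then 1 else 0 := fun w => by
    have h := congr_arg (Nat.cast : ℕ → ℝ) (heawood_card_common v w)
    push_cast at h
    rw [← h, Matrix.mul_apply, card_filter]
    push_cast
    refine sum_congr rfl fun u _ => ?_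
    simp only [SimpleGraph.adjMatrix_apply, ite_and, ite_mul, one_mul, zero_mul]
  rw [mulVec_mulVec, mulVec, dotProduct]
  simp only [hsq, add_mul, sum_add_distrib, ite_mul, zero_mul, one_mul]
  congr 1
  · simp
  · rw [Fintype.sum_prod_type, sum_comm]
    simp

/-- For an eigenvector `x` of norm one, `μ² = |A x|²` is `2` plus the squares of the sums of `x` over
the points and over the lines. -/
theorem sqrt_two_le_abs_heawood_eigenvalues (i : Bool × Fin 7) :
    √2 ≤ |(heawood.isHermitian_adjMatrix (R := ℝ)).eigenvalues i| := by
  obtain ⟨x, hx, hAx⟩ := exists_eigenvector (heawood.isHermitian_adjMatrix (R := ℝ)) i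
  set μ := (heawood.isHermitian_adjMatrix (R := ℝ)).eigenvalues i
  have h : ∀ v, μ ^ 2 * x v = 2 * x v + ∑ i, x (v.1, i) := fun v => by
    rw [← heawood_adjMatrix_mulVec_mulVec, hAx, mulVec_smul, hAx]
    simp only [Pi.smul_apply, smul_eq_mul]
    ring
  have hsum : μ ^ 2 = 2 + ∑ b, (∑ i, x (b, i)) ^ 2 := by
    calc μ ^ 2 = ∑ v, (μ ^ 2 * x v) * x v := by
          simp only [mul_assoc, ← mul_sum]
          rw [← dotProduct, hx, mul_one]
      _ = 2 * (x ⬝ᵥ x) + ∑ v : Bool × Fin 7, (∑ i, x (v.1, i)) * x v := by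
          simp only [h, add_mul, sum_add_distrib, mul_assoc, ← mul_sum, dotProduct]
      _ = _ := by
          rw [hx, mul_one, Fintype.sum_prod_type]
          simp only [← mul_sum, sq]
  rw [Real.sqrt_le_iff, sq_abs, hsum]
  exact ⟨abs_nonneg _, le_add_of_nonneg_right (sum_nonneg fun b _ => sq_nonneg _)⟩

theorem exists_eigenvalues_eq_lambdaH {V : Type*} [Fintype V] [DecidableEq V] [Nonempty V]
    (G : SimpleGraph V) [DecidableRel G.Adj] :
    ∃ i, lambdaH G = (G.isHermitian_adjMatrix (R := ℝ)).eigenvalues i :=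
  ⟨Fintype.equivOfCardEq (Fintype.card_fin _) _, by
    rw [IsHermitian.eigenvalues, Equiv.symm_apply_apply]; rfl⟩

/-! ### Median eigenvalues -/

theorem abs_median_eigenvalues_le {V : Type*} [Fintype V] [DecidableEq V] [Nonempty V]
    (G : SimpleGraph V) [DecidableRel G.Adj] (hG : G.maxDegree ≤ 3) :
    |lambdaH G| ≤ √2 ∧ |lambdaL G| ≤ √2 := by
  have hd : ∀ v, G.degree v ≤ 3 := fun v => (G.degree_le_maxDegree v).trans hG
  have hgt := two_mul_card_eigenvalues_gt hd
  have hlt := two_mul_card_eigenvalues_lt hd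
  have hH := indexH_eq (Fintype.card V)
  have hL := indexL_eq (Fintype.card V)
  refine ⟨abs_le.2 ⟨?_, ?_⟩, abs_le.2 ⟨?_, ?_⟩⟩ <;> by_contra! h
  · have := le_card_eigenvalues_lt h; omega
  · have := le_card_eigenvalues_gt h; omega
  · have := le_card_eigenvalues_lt h; omega
  · have := le_card_eigenvalues_gt h; omega

theorem isGreatest_hlIndexSet_three : IsGreatest (hlIndexSet 3) √2 := by
  have hle : ∀ r ∈ hlIndexSet 3, r ≤ √2 := by
    rintro r ⟨V, _, _, _, G, _, hG, rfl⟩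
    exact max_le_iff.2 (abs_median_eigenvalues_le G (by exact_mod_cast hG))
  refine ⟨?_, hle⟩
  have hmem : hlIndex heawood ∈ hlIndexSet 3 := by
    refine ⟨_, _, _, _, heawood, _, ?_, rfl⟩
    exact_mod_cast heawood.maxDegree_le_of_forall_degree_le 3 fun v => (heawood_degree v).le
  obtain ⟨i, hi⟩ := exists_eigenvalues_eq_lambdaH heawood
  have hge : √2 ≤ hlIndex heawood :=
    (hi ▸ sqrt_two_le_abs_heawood_eigenvalues i).trans (le_max_left _ _)
  rwa [← hge.antisymm (hle _ hmem)] at hmem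

theorem theorem2 :
    (∀ (V : Type*) [Fintype V] [DecidableEq V] [Nonempty V]
      (G : SimpleGraph V) [DecidableRel G.Adj], G.maxDegree ≤ 3 →
        lambdaH G ∈ Set.Icc (-√2 : ℝ) √2 ∧ lambdaL G ∈ Set.Icc (-√2 : ℝ) √2) ∧
    IsLUB (hlIndexSet 3) (hlIndexSup 3) ∧ hlIndexSup 3 = √2 := by
  have hsup : hlIndexSup 3 = √2 := isGreatest_hlIndexSet_three.csSup_eq
  refine ⟨fun V _ _ _ G _ hG => ?_, hsup ▸ isGreatest_hlIndexSet_three.isLUB, hsup⟩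
  obtain ⟨hH, hL⟩ := abs_median_eigenvalues_le G hG
  exact ⟨abs_le.1 hH, abs_le.1 hL⟩
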